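/- Let $Q$ be a smooth ($C^\infty$) finite-dimensional manifold, $g$ a smooth Riemannian metric on $Q$ and $D\subseteq TQ$ a smooth distribution of constant rank $k$. Let $\pi_Q:T^*Q\to Q$ be the cotangent bundle with its canonical symplectic form $\omega_Q=-d\theta=dq^i\wedge dp_i$, where $\theta$ is the Liouville form. Let $\flat_g:TQ\to T^*Q$, $v\mapsto g(v,\cdot)$, put $M=\flat_g(D)\subseteq T^*Q$, and let $\gamma:T^*Q\to M$ be the fibrewise projection that is orthogonal for the metric induced by $g$ on covectors. For $x\in M$ put $$T^D_xM=\{Y\in T_xM \mid T\pi_Q(Y)\in D\},\qquad (T^D_xM)^{\perp_{\omega_Q}}=\{Y\in T_x(T^*Q)\mid \omega_Q(W,Y)=0 \text{ for all } W\in T^D_xM\}.$$ Then $\gamma$ is smooth, and for every $x\in M$ one has $T_x(T^*Q)=T^D_xM\oplus (T^D_xM)^{\perp_{\omega_Q}}$; if $\mathcal P:T_x(T^*Q)\to T^D_xM$ denotes the projection given by this decomposition, then $$\mathcal P(Z)=T\gamma(Z)$$ for every $Z\in T_x(T^*Q)$ with $T\pi_Q(Z)\in D$. -/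

import Mathlib

open Bundle Set Filter Topology
open scoped Manifold ContDiff

namespace Nonholonomic

noncomputable section

/-- The exterior derivative of a one-form `α` on a normed space:
`dα_y(v, w) = (∂_v α)(w) - (∂_w α)(v)`. -/
def dOneForm {F : Type*} [NormedAddCommGroup F] [NormedSpace ℝ F] (α : F → F →L[ℝ] ℝ) (y : F) :
    LinearMap.BilinForm ℝ F :=
  LinearMap.mk₂ ℝ (fun v w => fderiv ℝ α y v w - fderiv ℝ α y w v)
    (by intro u v w; simp only [map_add, add_apply]; ring)
    (by intro c v w; simp only [map_smul, smul_apply, smul_eq_mul]; ring)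
    (by intro u v w; simp only [map_add, add_apply]; ring)
    (by intro c v w; simp only [map_smul, smul_apply, smul_eq_mul]; ring)

section Cotangent

variable (E : Type*) [NormedAddCommGroup E] [NormedSpace ℝ E]
  (Q : Type*) [TopologicalSpace Q] [ChartedSpace E Q] [IsManifold 𝓘(ℝ, E) ∞ Q]

/-- The cotangent bundle `T*Q` of a manifold `Q` modelled on `E`, as the vector bundle of
continuous linear forms on the tangent spaces (with Mathlib's topology and atlas). -/
abbrev CotangentBundle : Type _ :=
  TotalSpace (E →L[ℝ] ℝ) (fun q : Q => TangentSpace 𝓘(ℝ, E) q →L[ℝ] ℝ)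

/-- The model of `T*Q` as a manifold. -/
abbrev cotangentModel : ModelWithCorners ℝ (E × (E →L[ℝ] ℝ)) (ModelProd E (E →L[ℝ] ℝ)) :=
  𝓘(ℝ, E).prod 𝓘(ℝ, E →L[ℝ] ℝ)

variable {E Q}

/-- The bundle projection `π_Q : T*Q → Q`. -/
def cotangentProj (x : CotangentBundle E Q) : Q := x.proj

/-- The tangent map `T_x π_Q : T_x (T*Q) → T_q Q`, where `q = π_Q x`. -/
def tangentProj (x : CotangentBundle E Q) :
    TangentSpace (cotangentModel E) x →L[ℝ] TangentSpace 𝓘(ℝ, E) x.proj :=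
  mfderiv (cotangentModel E) 𝓘(ℝ, E) (cotangentProj : CotangentBundle E Q → Q) x

/-- The Liouville one-form `θ = p_i dq^i` on `T*Q`: `θ_x(v) = x (T π_Q v)`. -/
def liouvilleForm (x : CotangentBundle E Q) : TangentSpace (cotangentModel E) x →L[ℝ] ℝ :=
  x.snd.comp (tangentProj x)

/-- The expression of the Liouville form in the chart of `T*Q` around `x₀`: its pull-back by the
inverse of the chart, a one-form on (an open subset of) the model space. -/
def liouvilleInChart (x₀ : CotangentBundle E Q) (y : E × (E →L[ℝ] ℝ)) :
    (E × (E →L[ℝ] ℝ)) →L[ℝ] ℝ :=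
  (liouvilleForm ((extChartAt (cotangentModel E) x₀).symm y)).comp
    (mfderiv 𝓘(ℝ, E × (E →L[ℝ] ℝ)) (cotangentModel E) (extChartAt (cotangentModel E) x₀).symm y)

/-- The differential at `x` of the chart of `T*Q` around `x`. -/
def chartDifferential (x : CotangentBundle E Q) :
    TangentSpace (cotangentModel E) x →L[ℝ] (E × (E →L[ℝ] ℝ)) :=
  mfderiv (cotangentModel E) 𝓘(ℝ, E × (E →L[ℝ] ℝ)) (extChartAt (cotangentModel E) x) x

/-- The canonical symplectic form `ω_Q = -dθ = dq^i ∧ dp_i` on `T*Q`, with the exterior derivative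
computed in the chart around `x`. -/
def canonicalForm (x : CotangentBundle E Q) :
    LinearMap.BilinForm ℝ (TangentSpace (cotangentModel E) x) :=
  -(LinearMap.BilinForm.comp
      (dOneForm (liouvilleInChart x) (extChartAt (cotangentModel E) x x))
      (chartDifferential x).toLinearMap (chartDifferential x).toLinearMap)

/-- The tangent space at `x` of an embedded submanifold `N` of `T*Q`, as a subspace of
`T_x (T*Q)`: it is spanned by (in fact, for an embedded submanifold, it consists of) the
velocities at time `0` of the smooth curves that start at `x` and lie in `N`. -/
def submanifoldTangentSpace (N : Set (CotangentBundle E Q)) (x : CotangentBundle E Q) :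
    Submodule ℝ (TangentSpace (cotangentModel E) x) :=
  Submodule.span ℝ {v | ∃ (c : ℝ → CotangentBundle E Q) (ε : ℝ), 0 < ε ∧
    ContMDiffOn 𝓘(ℝ, ℝ) (cotangentModel E) ∞ c (Ioo (-ε) ε) ∧
    (∀ t ∈ Ioo (-ε) ε, c t ∈ N) ∧
    tangentMap 𝓘(ℝ, ℝ) (cotangentModel E) c ⟨0, (1 : ℝ)⟩ =
      (⟨x, v⟩ : TangentBundle (cotangentModel E) (CotangentBundle E Q))}

end Cotangent

section Metric

variable (E : Type*) [NormedAddCommGroup E] [NormedSpace ℝ E]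
  (Q : Type*) [TopologicalSpace Q] [ChartedSpace E Q] [IsManifold 𝓘(ℝ, E) ∞ Q]

/-- A smooth Riemannian metric on `Q`. -/
abbrev RiemannianMetricOn : Type _ :=
  ContMDiffRiemannianMetric 𝓘(ℝ, E) ∞ E (fun q : Q => TangentSpace 𝓘(ℝ, E) q)

/-- A smooth distribution of rank `k` on `Q`: a `k`-dimensional subspace of every tangent space,
locally spanned by `k` pointwise linearly independent smooth vector fields. -/
structure SmoothDistribution (k : ℕ) where
  space : ∀ q : Q, Submodule ℝ (TangentSpace 𝓘(ℝ, E) q)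
  exists_frame : ∀ q₀ : Q, ∃ U : Set Q, IsOpen U ∧ q₀ ∈ U ∧
    ∃ X : Fin k → ∀ q : Q, TangentSpace 𝓘(ℝ, E) q,
      (∀ i, ContMDiffOn 𝓘(ℝ, E) 𝓘(ℝ, E).tangent ∞
        (fun q => (⟨q, X i q⟩ : TangentBundle 𝓘(ℝ, E) Q)) U) ∧
      ∀ q ∈ U, LinearIndependent ℝ (fun i => X i q) ∧
        Submodule.span ℝ (range fun i => X i q) = space q

variable {E Q}

/-- Tangent spaces of a finite-dimensional manifold are finite-dimensional. -/
instance [FiniteDimensional ℝ E] (q : Q) : FiniteDimensional ℝ (TangentSpace 𝓘(ℝ, E) q) :=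
  inferInstanceAs (FiniteDimensional ℝ E)

/-- Cotangent spaces of a finite-dimensional manifold are finite-dimensional. -/
instance [FiniteDimensional ℝ E] (q : Q) :
    FiniteDimensional ℝ (TangentSpace 𝓘(ℝ, E) q →L[ℝ] ℝ) :=
  inferInstanceAs (FiniteDimensional ℝ (E →L[ℝ] ℝ))

theorem flat_injective (g : RiemannianMetricOn E Q) (q : Q) :
    Function.Injective (g.inner q).toLinearMap := by
  rw [← LinearMap.ker_eq_bot, LinearMap.ker_eq_bot']
  intro v hv
  by_contra h
  have h1 := g.pos q v h
  have h2 : g.inner q v = 0 := hv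
  rw [h2] at h1
  simp at h1

set_option linter.unusedSectionVars false in
theorem finrank_cotangent [FiniteDimensional ℝ E] (q : Q) :
    Module.finrank ℝ (TangentSpace 𝓘(ℝ, E) q) =
      Module.finrank ℝ (TangentSpace 𝓘(ℝ, E) q →L[ℝ] ℝ) := by
  change Module.finrank ℝ E = Module.finrank ℝ (E →L[ℝ] ℝ)
  rw [← (LinearMap.toContinuousLinearMap (𝕜 := ℝ) (E := E) (F' := ℝ)).finrank_eq]
  exact Subspace.dual_finrank_eq.symm

variable [FiniteDimensional ℝ E] {k : ℕ}

/-- The isomorphism `♭_g : T_q Q → T_q^* Q`, `v ↦ g(v, ·)`. Its inverse is `♯_g`. -/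
def flat (g : RiemannianMetricOn E Q) (q : Q) :
    TangentSpace 𝓘(ℝ, E) q ≃ₗ[ℝ] (TangentSpace 𝓘(ℝ, E) q →L[ℝ] ℝ) :=
  LinearEquiv.ofInjectiveOfFinrankEq (g.inner q).toLinearMap
    (flat_injective g q) (finrank_cotangent q)

theorem flat_apply (g : RiemannianMetricOn E Q) (q : Q) (v w : TangentSpace 𝓘(ℝ, E) q) :
    flat g q v w = g.inner q v w := rfl

/-- The metric induced by `g` on the covectors at `q`: `⟨α, β⟩ = g(♯_g α, ♯_g β)`. -/
def cometric (g : RiemannianMetricOn E Q) (q : Q) :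
    LinearMap.BilinForm ℝ (TangentSpace 𝓘(ℝ, E) q →L[ℝ] ℝ) :=
  LinearMap.mk₂ ℝ (fun α β => g.inner q ((flat g q).symm α) ((flat g q).symm β))
    (by intro u v w; simp only [map_add, add_apply])
    (by intro c v w; simp only [map_smul, smul_apply])
    (by intro u v w; simp only [map_add])
    (by intro c v w; simp only [map_smul])

/-- The fibre `M_q = ♭_g(D_q)` of the constraint submanifold. -/
def constraintFibre (g : RiemannianMetricOn E Q) (D : SmoothDistribution E Q k) (q : Q) :
    Submodule ℝ (TangentSpace 𝓘(ℝ, E) q →L[ℝ] ℝ) :=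
  (D.space q).map (flat g q : TangentSpace 𝓘(ℝ, E) q →ₗ[ℝ] _)

/-- The constraint submanifold `M = ♭_g(D)` of `T*Q`. -/
def constraintSubmanifold (g : RiemannianMetricOn E Q) (D : SmoothDistribution E Q k) :
    Set (CotangentBundle E Q) :=
  {x | x.snd ∈ constraintFibre g D x.proj}

theorem isCompl_constraintFibre (g : RiemannianMetricOn E Q) (D : SmoothDistribution E Q k)
    (q : Q) :
    IsCompl (constraintFibre g D q) ((cometric g q).orthogonal (constraintFibre g D q)) := by
  have hs : (cometric g q).IsRefl := by
    intro α β h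
    change g.inner q _ _ = 0
    rw [g.symm]
    exact h
  rw [LinearMap.BilinForm.isCompl_orthogonal_iff_disjoint hs, Submodule.disjoint_def]
  intro α h1 h2
  have h3 : g.inner q ((flat g q).symm α) ((flat g q).symm α) = 0 := h2 α h1
  by_contra h
  have h4 := g.pos q ((flat g q).symm α) (by simpa using h)
  exact h4.ne' h3

/-- The orthogonal projection `γ : T*Q → M` (composed with the inclusion `M → T*Q`), for the
metric induced by `g` on covectors. -/
def gamma (g : RiemannianMetricOn E Q) (D : SmoothDistribution E Q k)
    (x : CotangentBundle E Q) : CotangentBundle E Q :=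
  ⟨x.proj, Submodule.projection _ _ (isCompl_constraintFibre g D x.proj) x.snd⟩

/-- The fibre at `x` of `T^D(T*Q) = {Y ∈ T(T*Q) | T π_Q (Y) ∈ D}`. -/
def tangentOverD (D : SmoothDistribution E Q k) (x : CotangentBundle E Q) :
    Submodule ℝ (TangentSpace (cotangentModel E) x) :=
  (D.space x.proj).comap (tangentProj x : TangentSpace (cotangentModel E) x →ₗ[ℝ] _)

/-- The fibre at `x ∈ M` of `T^D M = {Y ∈ TM | T π_Q (Y) ∈ D}`. -/
def tangentDM (g : RiemannianMetricOn E Q) (D : SmoothDistribution E Q k)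
    (x : CotangentBundle E Q) : Submodule ℝ (TangentSpace (cotangentModel E) x) :=
  submanifoldTangentSpace (constraintSubmanifold g D) x ⊓ tangentOverD D x

end Metric

end

end Nonholonomic

open Nonholonomic

/-! The argument is linear algebra on `T_x(T*Q)`, fed by four facts about `A = T_x γ` at a point
`x` of `M`. Let `ver : T_q^*Q → T_x(T*Q)` be the vertical lift, whose range is `ker T π_Q`.

* `ω_Q(V, ver w) = w (T π_Q V)` (`canonicalForm_verticalLift`). In the chart of `T*Q` around `x` the
  Liouville form is the linear map `(y, p) ↦ p ∘ fst`, whose exterior derivative can be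
  read off; moreover the differential of the preferred chart at `x` is the identity.
* `γ` is smooth (`contMDiff_gamma`). In a local frame `X` of `D` it is
  `γ(α) = ∑ j, c_j ♭(X_j)`, where `c` solves the linear system of the Gram matrix `g(X_i, X_j)` with
  right-hand side `α(X_i)`; Cramer's rule shows that `c` is smooth in `α`.
* `T π_Q ∘ A = T π_Q`, `A ∘ A = A` and `A (ver w) = ver (γ w)`, by the chain rule
  applied to `π_Q ∘ γ = π_Q`, `γ ∘ γ = γ` and the linearity of `γ` on fibres.
* `T_x M` is the space of fixed vectors of `A` (`mem_submanifoldTangentSpace`), as `γ` is a smooth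
  retraction onto `M`. In particular `A` maps the vectors over `D` to `T^D_x M`.

For `Z` over `D` the difference `Z - A Z` is killed by `T π_Q` and by `A`, so it is `ver w` with `w`
orthogonal to `♭(D)`, that is, vanishing on `D`; hence it lies in the symplectic orthogonal of
`T^D_x M`. The latter is a symplectic subspace: if `Y` is in it and in its orthogonal, pairing with
`ver (♭ (T π_Q Y))` shows that `Y = ver (♭ u)` is vertical with `u` in `D`, and pairing with `A Z`,
where `T π_Q Z = u`, gives `g(u, u) = 0`. -/

namespace Nonholonomic

/-! ### The canonical form in the preferred chart -/

section Canonical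

variable {E : Type*} [NormedAddCommGroup E] [NormedSpace ℝ E]
  {Q : Type*} [TopologicalSpace Q] [ChartedSpace E Q] [IsManifold 𝓘(ℝ, E) ∞ Q]

/-- The fibre coordinate of a covector: its composition with the inverse trivialization of `TQ`. -/
theorem extChartAt_cotangent_snd (x z : CotangentBundle E Q) (v : E) :
    (extChartAt (cotangentModel E) x z).2 v =
      z.snd ((trivializationAt E (TangentSpace 𝓘(ℝ, E)) x.proj).symmL ℝ z.proj v) := by
  have h := congrArg Prod.snd (hom_chart (HB := E) (E₁ := (TangentSpace 𝓘(ℝ, E) : Q → Type _))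
    (E₂ := Bundle.Trivial Q ℝ) x z)
  refine (DFunLike.congr_fun h v).trans ?_
  simp [ContinuousLinearMap.inCoordinates]

theorem mem_extChartAt_cotangent_source {x z : CotangentBundle E Q} :
    z ∈ (extChartAt (cotangentModel E) x).source ↔ z.proj ∈ (chartAt E x.proj).source := by
  rw [FiberBundle.extChartAt]
  simp only [mfld_simps]
  exact ⟨fun h => h.1.1, fun h => ⟨⟨h, trivial⟩, h⟩⟩

theorem mdifferentiableAt_cotangentProj (x : CotangentBundle E Q) :
    MDifferentiableAt (cotangentModel E) 𝓘(ℝ, E) (cotangentProj : CotangentBundle E Q → Q) x :=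
  (contMDiff_proj (n := 1) (IB := 𝓘(ℝ, E)) (F := E →L[ℝ] ℝ)
    (fun q : Q => TangentSpace 𝓘(ℝ, E) q →L[ℝ] ℝ) x).mdifferentiableAt one_ne_zero

theorem cotangentProj_extChartAt_symm (x : CotangentBundle E Q) {y : E × (E →L[ℝ] ℝ)}
    (hy : y ∈ (extChartAt (cotangentModel E) x).target) :
    cotangentProj ((extChartAt (cotangentModel E) x).symm y) =
      (extChartAt 𝓘(ℝ, E) x.proj).symm y.1 := by
  have h1 := (extChartAt (cotangentModel E) x).map_target hy
  have h2 := (extChartAt (cotangentModel E) x).right_inv hy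
  have h3 : (extChartAt (cotangentModel E) x ((extChartAt (cotangentModel E) x).symm y)).1 =
    extChartAt 𝓘(ℝ, E) x.proj ((extChartAt (cotangentModel E) x).symm y).proj := rfl
  rw [h2] at h3
  rw [h3, (extChartAt 𝓘(ℝ, E) x.proj).left_inv]
  · rfl
  · rw [extChartAt_source]; exact mem_extChartAt_cotangent_source.1 h1

/-- `T_x (T*Q)` is the model space `E × E*`, by way of the preferred chart at `x`, in which `T π_Q` is
the first projection. -/
theorem tangentProj_apply (x : CotangentBundle E Q) (v : E × (E →L[ℝ] ℝ)) :
    tangentProj x v = v.1 := by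
  have h : HasMFDerivAt (cotangentModel E) 𝓘(ℝ, E) (cotangentProj : CotangentBundle E Q → Q) x
      (ContinuousLinearMap.fst ℝ E (E →L[ℝ] ℝ)) := by
    refine ⟨(mdifferentiableAt_cotangentProj x).continuousAt, ?_⟩
    have h1 : HasFDerivWithinAt (Prod.fst : E × (E →L[ℝ] ℝ) → E)
      (ContinuousLinearMap.fst ℝ E (E →L[ℝ] ℝ)) (range (cotangentModel E))
      (extChartAt (cotangentModel E) x x) := hasFDerivWithinAt_fst
    refine h1.congr_of_eventuallyEq ?_ ?_
    · filter_upwards [extChartAt_target_mem_nhdsWithin (I := cotangentModel E) x] with y hy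
      have h2 := congrArg Prod.fst ((extChartAt (cotangentModel E) x).right_inv hy)
      exact h2
    · have h2 := congrArg Prod.fst ((extChartAt (cotangentModel E) x).right_inv
        (mem_extChartAt_target (I := cotangentModel E) x))
      exact h2
  exact DFunLike.congr_fun h.mfderiv v

/-- The inverse of the chart of `T*Q` covers the inverse of the chart of `Q`, and the derivative of
the latter is the inverse trivialization of `TQ`. -/
theorem mfderiv_extChartAt_symm_cotangent_fst (x : CotangentBundle E Q) {y : E × (E →L[ℝ] ℝ)}
    (hy : y ∈ (extChartAt (cotangentModel E) x).target) (v : E × (E →L[ℝ] ℝ)) :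
    tangentProj ((extChartAt (cotangentModel E) x).symm y)
      (mfderiv 𝓘(ℝ, E × (E →L[ℝ] ℝ)) (cotangentModel E) (extChartAt (cotangentModel E) x).symm y v) =
      (trivializationAt E (TangentSpace 𝓘(ℝ, E)) x.proj).symmL ℝ
        ((extChartAt (cotangentModel E) x).symm y).proj v.1 := by
  set z := (extChartAt (cotangentModel E) x).symm y with hz
  have hzs : z ∈ (extChartAt (cotangentModel E) x).source :=
    (extChartAt (cotangentModel E) x).map_target hy
  have hzq := mem_extChartAt_cotangent_source.1 hzs
  have hzy : extChartAt 𝓘(ℝ, E) x.proj z.proj = y.1 :=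
    congrArg Prod.fst ((extChartAt (cotangentModel E) x).right_inv hy)
  have hdiff : MDifferentiableAt 𝓘(ℝ, E × (E →L[ℝ] ℝ)) (cotangentModel E)
      (extChartAt (cotangentModel E) x).symm y :=
    ((contMDiffOn_extChartAt_symm (n := 1) x).contMDiffAt
      ((isOpen_extChartAt_target x).mem_nhds hy)).mdifferentiableAt one_ne_zero
  have hy1 : y.1 ∈ (extChartAt 𝓘(ℝ, E) x.proj).target := by
    rw [← hzy]
    exact (extChartAt 𝓘(ℝ, E) x.proj).map_source (by rwa [extChartAt_source])
  have hdiff' : MDifferentiableAt 𝓘(ℝ, E) 𝓘(ℝ, E)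
      (extChartAt 𝓘(ℝ, E) x.proj).symm y.1 :=
    ((contMDiffOn_extChartAt_symm (n := 1) x.proj).contMDiffAt
      ((isOpen_extChartAt_target x.proj).mem_nhds hy1)).mdifferentiableAt one_ne_zero
  have h1 := (mdifferentiableAt_cotangentProj z).hasMFDerivAt.comp y hdiff.hasMFDerivAt
  have hfst : HasMFDerivAt 𝓘(ℝ, E × (E →L[ℝ] ℝ)) 𝓘(ℝ, E) (Prod.fst : E × (E →L[ℝ] ℝ) → E) y
      (ContinuousLinearMap.fst ℝ E (E →L[ℝ] ℝ)) := hasFDerivAt_fst.hasMFDerivAt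
  have h2 := hdiff'.hasMFDerivAt.comp y hfst
  have heq : (extChartAt 𝓘(ℝ, E) x.proj).symm ∘ (Prod.fst : E × (E →L[ℝ] ℝ) → E) =ᶠ[𝓝 y]
      (cotangentProj : CotangentBundle E Q → Q) ∘ (extChartAt (cotangentModel E) x).symm := by
    filter_upwards [(isOpen_extChartAt_target (I := cotangentModel E) x).mem_nhds hy] with w hw
    exact (cotangentProj_extChartAt_symm x hw).symm
  have h3 := hasMFDerivAt_unique (h1.congr_of_eventuallyEq heq) h2
  have h4 := DFunLike.congr_fun h3 v
  refine h4.trans ?_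
  rw [TangentBundle.symmL_trivializationAt hzq, hzy]
  simp only [modelWithCornersSelf_coe, range_id, mfderivWithin_univ]
  rfl

/-- The Liouville form is `p dq` throughout the chart: the inverse trivialization in the fibre
coordinate `p` cancels against the one in the derivative of the inverse chart. -/
theorem liouvilleInChart_apply (x : CotangentBundle E Q) {y : E × (E →L[ℝ] ℝ)}
    (hy : y ∈ (extChartAt (cotangentModel E) x).target) (v : E × (E →L[ℝ] ℝ)) :
    liouvilleInChart x y v = y.2 v.1 := by
  have h := extChartAt_cotangent_snd x ((extChartAt (cotangentModel E) x).symm y) v.1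
  rw [(extChartAt (cotangentModel E) x).right_inv hy] at h
  rw [h, ← mfderiv_extChartAt_symm_cotangent_fst x hy v]
  rfl

theorem chartDifferential_apply (x : CotangentBundle E Q) (v : E × (E →L[ℝ] ℝ)) :
    chartDifferential x v = v :=
  DFunLike.congr_fun (mfderiv_extChartAt_self (I := cotangentModel E) (x := x)) v

/-- The Liouville form `(y, p) ↦ p ∘ fst` of the model space `E × E*`, as a linear map. -/
noncomputable def modelLiouville (E : Type*) [NormedAddCommGroup E] [NormedSpace ℝ E] :
    (E × (E →L[ℝ] ℝ)) →L[ℝ] (E × (E →L[ℝ] ℝ)) →L[ℝ] ℝ :=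
  ((ContinuousLinearMap.compL ℝ (E × (E →L[ℝ] ℝ)) E ℝ).flip
    (ContinuousLinearMap.fst ℝ E (E →L[ℝ] ℝ))).comp (ContinuousLinearMap.snd ℝ E (E →L[ℝ] ℝ))

/-- The canonical form is `dq ∧ dp` in the preferred chart at `x`. -/
theorem canonicalForm_apply (x : CotangentBundle E Q) (v w : E × (E →L[ℝ] ℝ)) :
    canonicalForm x v w = w.2 v.1 - v.2 w.1 := by
  have heq : liouvilleInChart x =ᶠ[𝓝 (extChartAt (cotangentModel E) x x)] modelLiouville E := by
    filter_upwards [extChartAt_target_mem_nhds (I := cotangentModel E) x] with y hy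
    refine ContinuousLinearMap.ext fun v => ?_
    exact liouvilleInChart_apply x hy v
  have hd : fderiv ℝ (liouvilleInChart x) (extChartAt (cotangentModel E) x x) =
      modelLiouville E := by
    rw [heq.fderiv_eq, ContinuousLinearMap.fderiv]
  have h : canonicalForm x v w =
      -(fderiv ℝ (liouvilleInChart x) (extChartAt (cotangentModel E) x x)
          (chartDifferential x v) (chartDifferential x w) -
        fderiv ℝ (liouvilleInChart x) (extChartAt (cotangentModel E) x x)
          (chartDifferential x w) (chartDifferential x v)) := rfl
  rw [h, hd, chartDifferential_apply, chartDifferential_apply]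
  simp [modelLiouville]

end Canonical

/-! ### Smoothness of the orthogonal projection -/

section Smooth

theorem contDiff_det {k : ℕ} :
    ContDiff ℝ ∞ (fun A : Fin k → Fin k → ℝ => Matrix.det (Matrix.of A)) := by
  simp only [Matrix.det_apply, Matrix.of_apply]
  fun_prop

theorem contMDiffAt_det {F H N : Type*} [NormedAddCommGroup F] [NormedSpace ℝ F]
    [TopologicalSpace H] {I : ModelWithCorners ℝ F H} [TopologicalSpace N] [ChartedSpace H N]
    {k : ℕ} {A : N → Matrix (Fin k) (Fin k) ℝ} {x : N}
    (hA : ∀ i j, ContMDiffAt I 𝓘(ℝ, ℝ) ∞ (fun y => A y i j) x) :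
    ContMDiffAt I 𝓘(ℝ, ℝ) ∞ (fun y => (A y).det) x := by
  have h : ContMDiffAt I 𝓘(ℝ, Fin k → Fin k → ℝ) ∞ (fun y i j => A y i j) x :=
    contMDiffAt_pi_space.2 fun i => contMDiffAt_pi_space.2 fun j => hA i j
  exact contDiff_det.contDiffAt.contMDiffAt.comp x h

variable {E : Type*} [NormedAddCommGroup E] [NormedSpace ℝ E]
  {Q : Type*} [TopologicalSpace Q] [ChartedSpace E Q] [IsManifold 𝓘(ℝ, E) ∞ Q]
  (g : RiemannianMetricOn E Q) {k : ℕ} (D : SmoothDistribution E Q k)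

/-- The orthogonal complement of `♭_g(D)` for the cometric is the annihilator of `D`. -/
theorem mem_orthogonal_constraintFibre [FiniteDimensional ℝ E] {q : Q}
    {β : TangentSpace 𝓘(ℝ, E) q →L[ℝ] ℝ} :
    β ∈ (cometric g q).orthogonal (constraintFibre g D q) ↔ ∀ v ∈ D.space q, β v = 0 := by
  have h : ∀ v, cometric g q (flat g q v) β = β v := by
    intro v
    change g.inner q ((flat g q).symm (flat g q v)) ((flat g q).symm β) = β v
    rw [LinearEquiv.symm_apply_apply, g.symm, ← flat_apply, LinearEquiv.apply_symm_apply]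
  constructor
  · intro hβ v hv
    rw [← h]
    exact hβ _ (Submodule.mem_map_of_mem hv)
  · rintro hβ _ ⟨v, hv, rfl⟩
    exact (h v).trans (hβ v hv)

theorem projection_eq_of_mem {R V : Type*} [Ring R] [AddCommGroup V] [Module R V]
    {p q : Submodule R V} (h : IsCompl p q) {x y : V} (hy : y ∈ p) (hxy : x - y ∈ q) :
    Submodule.projection p q h x = y := by
  have h1 : Submodule.projection p q h (x - y) = 0 :=
    (Submodule.projection_apply_eq_zero_iff h).2 hxy
  rw [map_sub, sub_eq_zero] at h1
  exact h1.trans (Submodule.projection_apply_left h ⟨y, hy⟩)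

/-- The Gram matrix `g(X_i, X_j)` of a family of vector fields. -/
noncomputable def gramMatrix (X : Fin k → ∀ q : Q, TangentSpace 𝓘(ℝ, E) q) (q : Q) :
    Matrix (Fin k) (Fin k) ℝ :=
  Matrix.of fun i j => g.inner q (X i q) (X j q)

theorem det_gramMatrix_ne_zero {X : Fin k → ∀ q : Q, TangentSpace 𝓘(ℝ, E) q} {q : Q}
    (hX : LinearIndependent ℝ (fun i => X i q)) : (gramMatrix g X q).det ≠ 0 := by
  intro hdet
  obtain ⟨c, hc, hGc⟩ := Matrix.exists_mulVec_eq_zero_iff.2 hdet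
  have h1 : ∀ i, g.inner q (X i q) (∑ j, c j • X j q) = 0 := by
    intro i
    have := congrFun hGc i
    simpa [Matrix.mulVec, dotProduct, gramMatrix, mul_comm] using this
  have h2 : g.inner q (∑ i, c i • X i q) (∑ j, c j • X j q) = 0 := by
    have h : ∀ w, g.inner q (∑ i, c i • X i q) w = ∑ i, c i * g.inner q (X i q) w := by simp
    simp only [h, h1, mul_zero, Finset.sum_const_zero]
  have h3 : ∑ j, c j • X j q = 0 := by
    by_contra h
    exact (g.pos q _ h).ne' h2
  exact hc (funext (Fintype.linearIndependent_iff.1 hX c h3))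

/-- The coefficient of `♭_g(X_j)` in `γ(x)`, for a local frame `X` of the distribution: the solution
by Cramer's rule of the linear system `∑ j, g(X_i, X_j) c_j = x(X_i)`. -/
noncomputable def projectionCoeff (X : Fin k → ∀ q : Q, TangentSpace 𝓘(ℝ, E) q)
    (j : Fin k) (x : CotangentBundle E Q) : ℝ :=
  ((gramMatrix g X x.proj).det)⁻¹ *
    ((gramMatrix g X x.proj).updateCol j fun i => x.snd (X i x.proj)).det

/-- The projection `γ` in a local frame of the distribution. -/
theorem gamma_eq [FiniteDimensional ℝ E]
    {X : Fin k → ∀ q : Q, TangentSpace 𝓘(ℝ, E) q} {x : CotangentBundle E Q}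
    (hX : LinearIndependent ℝ (fun i => X i x.proj))
    (hspan : Submodule.span ℝ (range fun i => X i x.proj) = D.space x.proj) :
    gamma g D x =
      ⟨x.proj, ∑ j, projectionCoeff g X j x • g.inner x.proj (X j x.proj)⟩ := by
  have hmem : ∀ j, X j x.proj ∈ D.space x.proj := fun j =>
    hspan ▸ Submodule.subset_span (mem_range_self j)
  refine congrArg (TotalSpace.mk x.proj) (projection_eq_of_mem _ ?_ ?_)
  · exact Submodule.sum_mem _ fun j _ => Submodule.smul_mem _ _ (Submodule.mem_map_of_mem (hmem j))
  · rw [mem_orthogonal_constraintFibre, ← hspan]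
    have h1 : ∀ i, ∑ j, projectionCoeff g X j x * g.inner x.proj (X j x.proj) (X i x.proj) =
        x.snd (X i x.proj) := by
      intro i
      have h2 := congrFun (Matrix.mulVec_cramer (gramMatrix g X x.proj)
        (fun i => x.snd (X i x.proj))) i
      have h3 := det_gramMatrix_ne_zero g hX
      simp only [Matrix.mulVec, dotProduct, Matrix.cramer_apply, Pi.smul_apply, smul_eq_mul] at h2
      rw [← mul_right_inj' h3, ← h2, Finset.mul_sum]
      refine Finset.sum_congr rfl fun j _ => ?_
      rw [projectionCoeff, ← mul_assoc, mul_inv_cancel_left₀ h3, g.symm, mul_comm]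
      rfl
    intro v hv
    induction hv using Submodule.span_induction with
    | mem v hv =>
      obtain ⟨i, rfl⟩ := hv
      simp [← h1 i]
    | zero => simp
    | add v w _ _ hv hw => rw [map_add, hv, hw, add_zero]
    | smul c v _ hv => rw [map_smul, hv, smul_zero]

theorem contMDiff_gamma [FiniteDimensional ℝ E] :
    ContMDiff (cotangentModel E) (cotangentModel E) ∞ (gamma g D) := by
  intro x₀
  obtain ⟨U, hU, hx₀, X, hX, hXU⟩ := D.exists_frame x₀.proj
  have hproj : ContMDiffAt (cotangentModel E) 𝓘(ℝ, E) ∞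
      (fun x : CotangentBundle E Q => x.proj) x₀ :=
    contMDiff_proj (IB := 𝓘(ℝ, E)) (F := E →L[ℝ] ℝ)
      (fun q : Q => TangentSpace 𝓘(ℝ, E) q →L[ℝ] ℝ) x₀
  have hX' : ∀ i, ContMDiffAt (cotangentModel E) 𝓘(ℝ, E).tangent ∞
      (fun x : CotangentBundle E Q => (⟨x.proj, X i x.proj⟩ : TangentBundle 𝓘(ℝ, E) Q)) x₀ :=
    fun i => ((hX i).contMDiffAt (hU.mem_nhds hx₀)).comp x₀ hproj
  have hg : ContMDiffAt (cotangentModel E) (𝓘(ℝ, E).prod 𝓘(ℝ, E →L[ℝ] E →L[ℝ] ℝ)) ∞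
      (fun x : CotangentBundle E Q => TotalSpace.mk' (E →L[ℝ] E →L[ℝ] ℝ)
        (E := fun q : Q => TangentSpace 𝓘(ℝ, E) q →L[ℝ] TangentSpace 𝓘(ℝ, E) q →L[ℝ] ℝ)
        x.proj (g.inner x.proj)) x₀ :=
    (g.contMDiff x₀.proj).comp x₀ hproj
  have hflat : ∀ i, ContMDiffAt (cotangentModel E) (cotangentModel E) ∞
      (fun x : CotangentBundle E Q => (⟨x.proj, g.inner x.proj (X i x.proj)⟩ :
        CotangentBundle E Q)) x₀ :=
    fun i => hg.clm_bundle_apply (hX' i)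
  have hpair : ∀ (α : ∀ x : CotangentBundle E Q, TangentSpace 𝓘(ℝ, E) x.proj →L[ℝ] ℝ) (i),
      ContMDiffAt (cotangentModel E) (cotangentModel E) ∞
        (fun x : CotangentBundle E Q => (⟨x.proj, α x⟩ : CotangentBundle E Q)) x₀ →
      ContMDiffAt (cotangentModel E) 𝓘(ℝ, ℝ) ∞
        (fun x : CotangentBundle E Q => α x (X i x.proj)) x₀ := by
    intro α i hα
    have h : ContMDiffAt (cotangentModel E) (𝓘(ℝ, E).prod 𝓘(ℝ, ℝ)) ∞
        (fun x : CotangentBundle E Q => TotalSpace.mk' ℝ (E := Bundle.Trivial Q ℝ) x.proj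
          (α x (X i x.proj))) x₀ :=
      ContMDiffAt.clm_bundle_apply (F₁ := E) (E₁ := fun q : Q => TangentSpace 𝓘(ℝ, E) q)
        (E₂ := Bundle.Trivial Q ℝ) hα (hX' i)
    exact (contMDiffAt_totalSpace.1 h).2
  have hgram : ∀ i j, ContMDiffAt (cotangentModel E) 𝓘(ℝ, ℝ) ∞
      (fun x : CotangentBundle E Q => gramMatrix g X x.proj i j) x₀ :=
    fun i j => hpair _ j (hflat i)
  have hval : ∀ i, ContMDiffAt (cotangentModel E) 𝓘(ℝ, ℝ) ∞
      (fun x : CotangentBundle E Q => x.snd (X i x.proj)) x₀ :=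
    fun i => hpair _ i contMDiffAt_id
  have hcoeff : ∀ j, ContMDiffAt (cotangentModel E) 𝓘(ℝ, ℝ) ∞ (projectionCoeff g X j) x₀ := by
    intro j
    have h1 := contMDiffAt_det hgram
    have h2 : ContMDiffAt (cotangentModel E) 𝓘(ℝ, ℝ) ∞ (fun x : CotangentBundle E Q =>
        ((gramMatrix g X x.proj).updateCol j fun i => x.snd (X i x.proj)).det) x₀ := by
      refine contMDiffAt_det fun i l => ?_
      simp only [Matrix.updateCol_apply]
      split_ifs
      · exact hval i
      · exact hgram i l
    exact (h1.inv₀ (det_gramMatrix_ne_zero g (hXU _ hx₀).1)).mul h2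
  refine contMDiffAt_totalSpace.2 ⟨hproj, ?_⟩
  set e := trivializationAt (E →L[ℝ] ℝ) (fun q : Q => TangentSpace 𝓘(ℝ, E) q →L[ℝ] ℝ) x₀.proj
  have hsum : ContMDiffAt (cotangentModel E) 𝓘(ℝ, E →L[ℝ] ℝ) ∞ (fun x : CotangentBundle E Q =>
      ∑ j, projectionCoeff g X j x • (e ⟨x.proj, g.inner x.proj (X j x.proj)⟩).2) x₀ :=
    contMDiffAt_finsetSum fun j _ => (hcoeff j).smul (contMDiffAt_totalSpace.1 (hflat j)).2
  refine hsum.congr_of_eventuallyEq ?_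
  filter_upwards [hproj.continuousAt.preimage_mem_nhds (hU.mem_nhds hx₀),
    hproj.continuousAt.preimage_mem_nhds
      (e.open_baseSet.mem_nhds (FiberBundle.mem_baseSet_trivializationAt' x₀.proj))] with x hxU hxe
  have h1 := gamma_eq g D (hXU _ hxU).1 (hXU _ hxU).2
  have h2 : ∀ α : TangentSpace 𝓘(ℝ, E) x.proj →L[ℝ] ℝ,
      (e ⟨x.proj, α⟩).2 = e.linearMapAt ℝ x.proj α := by
    intro α
    rw [Trivialization.coe_linearMapAt_of_mem e hxe]
  change (e (gamma g D x)).2 = _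
  rw [h1, h2, map_sum]
  simp only [map_smul, h2]

end Smooth

/-! ### The tangent map of the orthogonal projection -/

section Curves

variable {E : Type*} [NormedAddCommGroup E] [NormedSpace ℝ E]
  {Q : Type*} [TopologicalSpace Q] [ChartedSpace E Q] [IsManifold 𝓘(ℝ, E) ∞ Q]

/-- Every tangent vector of `T*Q` is the velocity of a smooth curve: a straight line in the chart. -/
theorem exists_curve (x : CotangentBundle E Q) (v : TangentSpace (cotangentModel E) x) :
    ∃ (c : ℝ → CotangentBundle E Q) (ε : ℝ), 0 < ε ∧
      ContMDiffOn 𝓘(ℝ, ℝ) (cotangentModel E) ∞ c (Ioo (-ε) ε) ∧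
      tangentMap 𝓘(ℝ, ℝ) (cotangentModel E) c ⟨0, (1 : ℝ)⟩ =
        (⟨x, v⟩ : TangentBundle (cotangentModel E) (CotangentBundle E Q)) := by
  set φ := extChartAt (cotangentModel E) x with hφ
  let v' : E × (E →L[ℝ] ℝ) := v
  let l : ℝ → E × (E →L[ℝ] ℝ) := fun t => φ x + t • v'
  have hl : ContDiff ℝ ∞ l := by fun_prop
  have hl0 : l 0 = φ x := by simp [l]
  have hopen : IsOpen (l ⁻¹' φ.target) := (isOpen_extChartAt_target x).preimage hl.continuous
  have hmem : (0 : ℝ) ∈ l ⁻¹' φ.target := by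
    rw [mem_preimage, hl0]
    exact mem_extChartAt_target x
  obtain ⟨ε, hε, hball⟩ := Metric.isOpen_iff.1 hopen 0 hmem
  rw [Real.ball_eq_Ioo, zero_sub, zero_add] at hball
  have hsmooth : ContMDiffOn 𝓘(ℝ, ℝ) (cotangentModel E) ∞ (φ.symm ∘ l) (Ioo (-ε) ε) :=
    (contMDiffOn_extChartAt_symm x).comp hl.contMDiff.contMDiffOn hball
  have h0 : (φ.symm ∘ l) 0 = x := by
    rw [Function.comp_apply, hl0]
    exact extChartAt_to_inv x
  have hderiv : HasMFDerivAt 𝓘(ℝ, ℝ) (cotangentModel E) (φ.symm ∘ l) 0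
      (ContinuousLinearMap.toSpanSingleton ℝ v') := by
    refine ⟨(hsmooth.contMDiffAt (Ioo_mem_nhds (by linarith) hε)).continuousAt, ?_⟩
    have h1 : HasFDerivAt l (ContinuousLinearMap.toSpanSingleton ℝ v') 0 :=
       (ContinuousLinearMap.toSpanSingleton ℝ v').hasFDerivAt.const_add (φ x)
    have h2 : HasFDerivAt (extChartAt (cotangentModel E) ((φ.symm ∘ l) 0) ∘ (φ.symm ∘ l))
        (ContinuousLinearMap.toSpanSingleton ℝ v') 0 := by
      rw [h0]
      refine h1.congr_of_eventuallyEq ?_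
      filter_upwards [hopen.mem_nhds hmem] with t ht
      exact φ.right_inv ht
    exact h2.hasFDerivWithinAt
  refine ⟨φ.symm ∘ l, ε, hε, hsmooth, ?_⟩
  -- The base point of the velocity is `x` only propositionally, but all tangent spaces are the
  -- model space.
  have hcast : ∀ y, y = x → ∀ w : E × (E →L[ℝ] ℝ), w = v' →
      (⟨y, w⟩ : TangentBundle (cotangentModel E) (CotangentBundle E Q)) = ⟨x, v⟩ := by
    rintro y rfl w rfl
    rfl
  exact hcast _ h0 _ ((DFunLike.congr_fun hderiv.mfderiv (1 : ℝ)).trans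
    (ContinuousLinearMap.toSpanSingleton_apply_one ..))

/-- The preferred chart at a point of a fibre is the identity on the whole of that fibre. -/
theorem extChartAt_cotangent_fibre (q : Q) (p₀ p : TangentSpace 𝓘(ℝ, E) q →L[ℝ] ℝ) :
    extChartAt (cotangentModel E) (⟨q, p₀⟩ : CotangentBundle E Q) ⟨q, p⟩ =
      (extChartAt 𝓘(ℝ, E) q q, (p : E →L[ℝ] ℝ)) := by
  refine Prod.ext rfl (ContinuousLinearMap.ext fun v => ?_)
  refine (extChartAt_cotangent_snd _ _ v).trans ?_
  change p _ = p v
  congr 1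
  rw [TangentBundle.symmL_trivializationAt (mem_chart_source E q),
    mfderivWithin_range_extChartAt_symm]
  rfl

theorem hasMFDerivAt_fibre (q : Q) (p : TangentSpace 𝓘(ℝ, E) q →L[ℝ] ℝ) :
    HasMFDerivAt 𝓘(ℝ, E →L[ℝ] ℝ) (cotangentModel E)
      (fun α : E →L[ℝ] ℝ => (⟨q, α⟩ : CotangentBundle E Q)) p
      (ContinuousLinearMap.inr ℝ E (E →L[ℝ] ℝ)) := by
  have h0 : ∀ α : E →L[ℝ] ℝ, (⟨q, α⟩ : CotangentBundle E Q) ∈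
      (extChartAt (cotangentModel E) (⟨q, p⟩ : CotangentBundle E Q)).source := fun α =>
    mem_extChartAt_cotangent_source.2 (mem_chart_source E q)
  have h1 : ∀ α : E →L[ℝ] ℝ, (⟨q, α⟩ : CotangentBundle E Q) =
      (extChartAt (cotangentModel E) (⟨q, p⟩ : CotangentBundle E Q)).symm
        (extChartAt 𝓘(ℝ, E) q q, α) := by
    intro α
    exact ((extChartAt _ _).left_inv (h0 α)).symm.trans
      (congrArg _ (extChartAt_cotangent_fibre q p α))
  constructor
  · rw [funext h1]
    have h2 := continuousAt_extChartAt_symm (I := cotangentModel E) (⟨q, p⟩ : CotangentBundle E Q)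
    rw [extChartAt_cotangent_fibre] at h2
    exact h2.comp (f := fun α : E →L[ℝ] ℝ => (extChartAt 𝓘(ℝ, E) q q, α)) (by fun_prop)
  · have h2 : HasFDerivAt (fun α : E →L[ℝ] ℝ => (extChartAt 𝓘(ℝ, E) q q, α))
        (ContinuousLinearMap.inr ℝ E (E →L[ℝ] ℝ)) p := hasFDerivAt_prodMk_right _ _
    refine (h2.congr_of_eventuallyEq (Eventually.of_forall fun α => ?_)).hasFDerivWithinAt
    exact extChartAt_cotangent_fibre q p α

variable (x : CotangentBundle E Q)

/-- The vertical lift `T_q^*Q → T_x (T*Q)`, where `q = π_Q x`: the derivative of the inclusion of the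
fibre, by `hasMFDerivAt_fibre`, and the inclusion of the second factor when `T_x (T*Q)` is
identified with the model space `E × E*`. -/
noncomputable def verticalLift :
    (TangentSpace 𝓘(ℝ, E) x.proj →L[ℝ] ℝ) →ₗ[ℝ] TangentSpace (cotangentModel E) x :=
  LinearMap.inr ℝ E (E →L[ℝ] ℝ)

theorem verticalLift_injective : Function.Injective (verticalLift x) :=
  LinearMap.inr_injective (R := ℝ) (M := E) (M₂ := E →L[ℝ] ℝ)

theorem tangentProj_verticalLift (w : TangentSpace 𝓘(ℝ, E) x.proj →L[ℝ] ℝ) :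
    tangentProj x (verticalLift x w) = 0 :=
  tangentProj_apply x _

theorem exists_verticalLift {v : TangentSpace (cotangentModel E) x} (hv : tangentProj x v = 0) :
    ∃ w, verticalLift x w = v :=
  ⟨(v : E × (E →L[ℝ] ℝ)).2, Prod.ext ((tangentProj_apply x v).symm.trans hv).symm rfl⟩

theorem tangentProj_surjective : Function.Surjective (tangentProj x) := fun v =>
  ⟨((v, 0) : E × (E →L[ℝ] ℝ)), tangentProj_apply x _⟩

theorem canonicalForm_verticalLift (v : TangentSpace (cotangentModel E) x)
    (w : TangentSpace 𝓘(ℝ, E) x.proj →L[ℝ] ℝ) :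
    canonicalForm x v (verticalLift x w) = w (tangentProj x v) := by
  rw [show tangentProj x v = _ from tangentProj_apply x v]
  refine (canonicalForm_apply x v _).trans ?_
  change w _ - (v : E × (E →L[ℝ] ℝ)).2 0 = w _
  rw [map_zero, sub_zero]

theorem canonicalForm_swap (v w : TangentSpace (cotangentModel E) x) :
    canonicalForm x w v = -canonicalForm x v w :=
  (canonicalForm_apply x w v).trans
    ((neg_sub _ _).symm.trans (congrArg Neg.neg (canonicalForm_apply x v w).symm))

end Curves

section Projection

variable {E : Type*} [NormedAddCommGroup E] [NormedSpace ℝ E] [FiniteDimensional ℝ E]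
  {Q : Type*} [TopologicalSpace Q] [ChartedSpace E Q] [IsManifold 𝓘(ℝ, E) ∞ Q]
  (g : RiemannianMetricOn E Q) {k : ℕ} (D : SmoothDistribution E Q k)

theorem gamma_mem (x : CotangentBundle E Q) : gamma g D x ∈ constraintSubmanifold g D :=
  Submodule.projection_apply_mem (isCompl_constraintFibre g D x.proj) x.snd

variable {g D} in
theorem gamma_eq_self {x : CotangentBundle E Q} (hx : x ∈ constraintSubmanifold g D) :
    gamma g D x = x :=
  congrArg (TotalSpace.mk x.proj)
    (Submodule.projection_apply_left (isCompl_constraintFibre g D x.proj) ⟨x.snd, hx⟩)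

theorem mdifferentiableAt_gamma (x : CotangentBundle E Q) :
    MDifferentiableAt (cotangentModel E) (cotangentModel E) (gamma g D) x :=
  (contMDiff_gamma g D x).mdifferentiableAt (by simp)

/-- The tangent map `T_x γ` as an endomorphism of `T_x (T*Q)`. Its values are tangent vectors at
`γ x`, so that it has this meaning only where `γ x = x`, that is, on `M`; elsewhere both tangent
spaces are merely identified with the model space `E × E*`. -/
noncomputable def gammaDifferential (x : CotangentBundle E Q) :
    TangentSpace (cotangentModel E) x →ₗ[ℝ] TangentSpace (cotangentModel E) x :=
  (mfderiv (cotangentModel E) (cotangentModel E) (gamma g D) x).toLinearMap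

variable {g D} in
theorem tangentMap_gamma {x : CotangentBundle E Q} (hx : x ∈ constraintSubmanifold g D)
    (v : TangentSpace (cotangentModel E) x) :
    tangentMap (cotangentModel E) (cotangentModel E) (gamma g D) ⟨x, v⟩ =
      (⟨x, gammaDifferential g D x v⟩ :
        TangentBundle (cotangentModel E) (CotangentBundle E Q)) := by
  have h : ∀ y, y = x → ∀ w : E × (E →L[ℝ] ℝ),
      (⟨y, w⟩ : TangentBundle (cotangentModel E) (CotangentBundle E Q)) = ⟨x, w⟩ := by
    rintro y rfl w
    rfl
  exact h _ (gamma_eq_self hx) _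

variable {g D} in
theorem gammaDifferential_eq_self_iff {x : CotangentBundle E Q}
    (hx : x ∈ constraintSubmanifold g D) (v : TangentSpace (cotangentModel E) x) :
    gammaDifferential g D x v = v ↔
      tangentMap (cotangentModel E) (cotangentModel E) (gamma g D) ⟨x, v⟩ =
        (⟨x, v⟩ : TangentBundle (cotangentModel E) (CotangentBundle E Q)) := by
  rw [tangentMap_gamma hx, TotalSpace.mk_inj]

theorem tangentProj_gammaDifferential (x : CotangentBundle E Q)
    (v : TangentSpace (cotangentModel E) x) :
    tangentProj x (gammaDifferential g D x v) = tangentProj x v := by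
  have h1 := (mdifferentiableAt_cotangentProj (gamma g D x)).hasMFDerivAt.comp x
    (mdifferentiableAt_gamma g D x).hasMFDerivAt
  have h2 : HasMFDerivAt (cotangentModel E) 𝓘(ℝ, E)
      (cotangentProj : CotangentBundle E Q → Q) x (tangentProj x) :=
    (mdifferentiableAt_cotangentProj x).hasMFDerivAt
  have h3 := DFunLike.congr_fun (hasMFDerivAt_unique h1 h2) v
  exact (tangentProj_apply x _).trans ((tangentProj_apply (gamma g D x) _).symm.trans h3)

theorem gammaDifferential_verticalLift (x : CotangentBundle E Q)
    (w : TangentSpace 𝓘(ℝ, E) x.proj →L[ℝ] ℝ) :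
    gammaDifferential g D x (verticalLift x w) =
      verticalLift x (Submodule.projection _ _ (isCompl_constraintFibre g D x.proj) w) := by
  let P' : (TangentSpace 𝓘(ℝ, E) x.proj →L[ℝ] ℝ) →ₗ[ℝ] (TangentSpace 𝓘(ℝ, E) x.proj →L[ℝ] ℝ) :=
    Submodule.projection _ _ (isCompl_constraintFibre g D x.proj)
  let P : (E →L[ℝ] ℝ) →L[ℝ] (E →L[ℝ] ℝ) :=
    LinearMap.toContinuousLinearMap (P' : (E →L[ℝ] ℝ) →ₗ[ℝ] (E →L[ℝ] ℝ))
  let p : E →L[ℝ] ℝ := x.snd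
  have h1 := (mdifferentiableAt_gamma g D x).hasMFDerivAt.comp p
    (hasMFDerivAt_fibre x.proj p)
  have h2 := (hasMFDerivAt_fibre x.proj (P p)).comp p P.hasMFDerivAt
  exact DFunLike.congr_fun (hasMFDerivAt_unique h1 h2) w

variable {g D}

/-- As `γ` is a smooth retraction onto `M`, the space `T_x M` consists of the fixed vectors of `T_x γ`:
velocities of curves in `M` are fixed, and conversely `γ` moves a curve into `M` without
changing a velocity that is fixed. -/
theorem mem_submanifoldTangentSpace {x : CotangentBundle E Q}
    (hx : x ∈ constraintSubmanifold g D) {v : TangentSpace (cotangentModel E) x} :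
    v ∈ submanifoldTangentSpace (constraintSubmanifold g D) x ↔
      gammaDifferential g D x v = v := by
  constructor
  · intro hv
    induction hv using Submodule.span_induction with
    | mem v hv =>
      obtain ⟨c, ε, hε, hc, hcM, hcv⟩ := hv
      rw [gammaDifferential_eq_self_iff hx, ← hcv]
      have h0 : Ioo (-ε) ε ∈ 𝓝 (0 : ℝ) := Ioo_mem_nhds (by linarith) hε
      have hd : MDifferentiableAt 𝓘(ℝ, ℝ) (cotangentModel E) c 0 :=
        (hc.contMDiffAt h0).mdifferentiableAt (by simp)
      rw [← tangentMap_comp_at (I := 𝓘(ℝ, ℝ)) (⟨0, (1 : ℝ)⟩ : TangentBundle 𝓘(ℝ, ℝ) ℝ)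
        (mdifferentiableAt_gamma g D (c 0)) hd]
      have heq : gamma g D ∘ c =ᶠ[𝓝 0] c := by
        filter_upwards [h0] with t ht
        exact gamma_eq_self (hcM t ht)
      exact TotalSpace.ext heq.eq_of_nhds (by
        change HEq (mfderiv 𝓘(ℝ, ℝ) (cotangentModel E) (gamma g D ∘ c) 0 (1 : ℝ)) _
        rw [heq.mfderiv_eq]; rfl)
    | zero => exact map_zero _
    | add v w _ _ hv hw => rw [map_add, hv, hw]
    | smul a v _ hv => rw [map_smul, hv]
  · intro hv
    obtain ⟨c, ε, hε, hc, hcv⟩ := exists_curve x v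
    have hd : MDifferentiableAt 𝓘(ℝ, ℝ) (cotangentModel E) c 0 :=
      (hc.contMDiffAt (Ioo_mem_nhds (by linarith) hε)).mdifferentiableAt (by simp)
    refine Submodule.subset_span ⟨gamma g D ∘ c, ε, hε,
      (contMDiff_gamma g D).comp_contMDiffOn hc, fun t _ => gamma_mem g D (c t), ?_⟩
    rw [tangentMap_comp_at (I := 𝓘(ℝ, ℝ)) (⟨0, (1 : ℝ)⟩ : TangentBundle 𝓘(ℝ, ℝ) ℝ)
        (mdifferentiableAt_gamma g D (c 0)) hd, hcv]
    exact (gammaDifferential_eq_self_iff hx v).1 hv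

theorem gammaDifferential_idem {x : CotangentBundle E Q} (hx : x ∈ constraintSubmanifold g D)
    (v : TangentSpace (cotangentModel E) x) :
    gammaDifferential g D x (gammaDifferential g D x v) = gammaDifferential g D x v := by
  rw [gammaDifferential_eq_self_iff hx, ← tangentMap_gamma hx,
    ← tangentMap_comp_at (I := cotangentModel E)
      (⟨x, v⟩ : TangentBundle (cotangentModel E) (CotangentBundle E Q))
      (mdifferentiableAt_gamma g D _) (mdifferentiableAt_gamma g D _)]
  have h : gamma g D ∘ gamma g D = gamma g D := funext fun y => gamma_eq_self (gamma_mem g D y)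
  rw [h]

theorem mem_tangentDM {x : CotangentBundle E Q} (hx : x ∈ constraintSubmanifold g D)
    {v : TangentSpace (cotangentModel E) x} :
    v ∈ tangentDM g D x ↔ gammaDifferential g D x v = v ∧ tangentProj x v ∈ D.space x.proj := by
  rw [tangentDM, Submodule.mem_inf, mem_submanifoldTangentSpace hx]
  rfl

theorem gammaDifferential_mem_tangentDM {x : CotangentBundle E Q}
    (hx : x ∈ constraintSubmanifold g D) {Z : TangentSpace (cotangentModel E) x}
    (hZ : tangentProj x Z ∈ D.space x.proj) :
    gammaDifferential g D x Z ∈ tangentDM g D x :=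
  (mem_tangentDM hx).2 ⟨gammaDifferential_idem hx Z,
    (tangentProj_gammaDifferential g D x Z).symm ▸ hZ⟩

theorem sub_gammaDifferential_mem_orthogonal {x : CotangentBundle E Q}
    (hx : x ∈ constraintSubmanifold g D) (Z : TangentSpace (cotangentModel E) x) :
    Z - gammaDifferential g D x Z ∈ (canonicalForm x).orthogonal (tangentDM g D x) := by
  intro W hW
  obtain ⟨w, hw⟩ := exists_verticalLift x (v := Z - gammaDifferential g D x Z)
    (((tangentProj x).toLinearMap.map_sub Z _).trans
      (sub_eq_zero.2 (tangentProj_gammaDifferential g D x Z).symm))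
  have h1 : verticalLift x
      (Submodule.projection _ _ (isCompl_constraintFibre g D x.proj) w) = 0 := by
    rw [← gammaDifferential_verticalLift, hw, map_sub, gammaDifferential_idem hx, sub_self]
  have h2 := (Submodule.projection_apply_eq_zero_iff _).1
    ((map_eq_zero_iff _ (verticalLift_injective x)).1 h1)
  rw [← hw]
  exact (canonicalForm_verticalLift x W w).trans
    ((mem_orthogonal_constraintFibre g D).1 h2 _ ((mem_tangentDM hx).1 hW).2)

/-- The subspace `T^D_x M` is symplectic. -/
theorem disjoint_tangentDM_orthogonal {x : CotangentBundle E Q}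
    (hx : x ∈ constraintSubmanifold g D) :
    Disjoint (tangentDM g D x) ((canonicalForm x).orthogonal (tangentDM g D x)) := by
  rw [Submodule.disjoint_def]
  intro Y hY hYo
  obtain ⟨hYγ, hYD⟩ := (mem_tangentDM hx).1 hY
  have hd0 : tangentProj x Y = 0 := by
    by_contra hne
    -- Test against the vertical lift of `♭ (T π_Q Y)`, which is tangent to `M`.
    have hW : verticalLift x (flat g x.proj (tangentProj x Y)) ∈ tangentDM g D x := by
      refine (mem_tangentDM hx).2 ⟨?_, ?_⟩
      · rw [gammaDifferential_verticalLift]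
        exact congrArg (verticalLift x) (Submodule.projection_apply_left
          (isCompl_constraintFibre g D x.proj) ⟨_, Submodule.mem_map_of_mem hYD⟩)
      · rw [tangentProj_verticalLift]
        exact Submodule.zero_mem _
    have h : canonicalForm x _ Y = 0 := hYo _ hW
    rw [canonicalForm_swap, canonicalForm_verticalLift, flat_apply, neg_eq_zero] at h
    exact (g.pos _ _ hne).ne' h
  obtain ⟨w, rfl⟩ := exists_verticalLift x hd0
  rw [gammaDifferential_verticalLift] at hYγ
  have hwM : w ∈ constraintFibre g D x.proj := by
    rw [← verticalLift_injective x hYγ]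
    exact Submodule.projection_apply_mem _ _
  obtain ⟨u, hu, rfl⟩ := hwM
  -- Now `Y` is the vertical lift of `♭ u`; test against a vector of `T^D_x M` that projects to `u`.
  obtain ⟨Z, rfl⟩ := tangentProj_surjective x u
  have h : canonicalForm x _ _ = 0 := hYo _ (gammaDifferential_mem_tangentDM hx hu)
  rw [canonicalForm_verticalLift, tangentProj_gammaDifferential] at h
  have hu0 : tangentProj x Z = 0 := by
    by_contra hne
    exact (g.pos _ _ hne).ne' h
  rw [hu0, map_zero, map_zero]

theorem isCompl_tangentDM {x : CotangentBundle E Q} (hx : x ∈ constraintSubmanifold g D) :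
    IsCompl (tangentDM g D x) ((canonicalForm x).orthogonal (tangentDM g D x)) := by
  have : FiniteDimensional ℝ (TangentSpace (cotangentModel E) x) :=
    inferInstanceAs (FiniteDimensional ℝ (E × (E →L[ℝ] ℝ)))
  have hs : (canonicalForm x).IsRefl := fun v w h => by rw [canonicalForm_swap, h, neg_zero]
  exact (LinearMap.BilinForm.isCompl_orthogonal_iff_disjoint hs).2
    (disjoint_tangentDM_orthogonal hx)

end Projection

end Nonholonomic

theorem proposition2
    {E : Type*} [NormedAddCommGroup E] [NormedSpace ℝ E] [FiniteDimensional ℝ E]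
    {Q : Type*} [TopologicalSpace Q] [ChartedSpace E Q] [IsManifold 𝓘(ℝ, E) ∞ Q]
    (g : RiemannianMetricOn E Q) {k : ℕ} (D : SmoothDistribution E Q k) :
    ContMDiff (cotangentModel E) (cotangentModel E) ∞ (gamma g D) ∧
    ∀ x ∈ constraintSubmanifold g D,
      ∃ hc : IsCompl (tangentDM g D x) ((canonicalForm x).orthogonal (tangentDM g D x)),
        ∀ Z ∈ tangentOverD D x,
          (⟨x, Submodule.projection _ _ hc Z⟩ : TangentBundle (cotangentModel E) (CotangentBundle E Q)) =
            tangentMap (cotangentModel E) (cotangentModel E) (gamma g D) ⟨x, Z⟩ := by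
  refine ⟨contMDiff_gamma g D, fun x hx => ⟨isCompl_tangentDM hx, fun Z hZ => ?_⟩⟩
  rw [tangentMap_gamma hx, projection_eq_of_mem _ (gammaDifferential_mem_tangentDM hx hZ)
    (sub_gammaDifferential_mem_orthogonal hx Z)]
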